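/- Let $n\ge 1$. A quasi-Stirling permutation of size $n$ is an arrangement $\pi=\pi_1\pi_2\cdots\pi_{2n}$ of the multiset $\{1,1,2,2,\dots,n,n\}$ for which there do not exist positions $i<j<k<\ell$ with $\pi_i=\pi_k$ and $\pi_j=\pi_\ell$ (equivalently, $\pi$ avoids the patterns $1212$ and $2121$); let $\overline{\mathcal Q}_n$ be the set of these. For $\pi\in\overline{\mathcal Q}_n$, let $\mathrm{asc}(\pi)$ be the number of ascents, i.e. indices $i\in\{0,1,\dots,2n-1\}$ such that $i=0$ or $\pi_i<\pi_{i+1}$; let $\mathrm{des}(\pi)$ be the number of descents, i.e. indices $i\in\{1,\dots,2n\}$ such that $i=2n$ or $\pi_i>\pi_{i+1}$; and let $\mathrm{plat}(\pi)$ be the number of plateaus, i.e. indices $i\in\{1,\dots,2n-1\}$ such that $\pi_i=\pi_{i+1}$. Then $$\frac{1}{|\overline{\mathcal Q}_n|}\sum_{\pi\in\overline{\mathcal Q}_n}\mathrm{asc}(\pi)=\frac{3n+1}{4},\qquad \frac{1}{|\overline{\mathcal Q}_n|}\sum_{\pi\in\overline{\mathcal Q}_n}\mathrm{des}(\pi)=\frac{3n+1}{4},\qquad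 \frac{1}{|\overline{\mathcal Q}_n|}\sum_{\pi\in\overline{\mathcal Q}_n}\mathrm{plat}(\pi)=\frac{n+1}{2}.$$ -/

import Mathlib

namespace QuasiStirling

/-- The letter `π_i` (for `1 ≤ i ≤ r`) of the word `π = π_1 π_2 … π_r`.
The value for other `i` is irrelevant. -/
def letter (π : List ℕ) (i : ℕ) : ℕ := π.getD (i - 1) 0

/-- `asc(π)`: the number of ascents of `π = π_1 … π_r`, the indices `i ∈ {0, …, r - 1}`
such that `i = 0` or `π_i < π_{i+1}`. -/
def asc (π : List ℕ) : ℕ :=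
  ((Finset.range π.length).filter
    (fun i => i = 0 ∨ letter π i < letter π (i + 1))).card

/-- `des(π)`: the number of descents of `π = π_1 … π_r`, the indices `i ∈ {1, …, r}`
such that `i = r` or `π_i > π_{i+1}`. -/
def des (π : List ℕ) : ℕ :=
  ((Finset.Icc 1 π.length).filter
    (fun i => i = π.length ∨ letter π i > letter π (i + 1))).card

/-- `plat(π)`: the number of plateaus of `π = π_1 … π_r`, the indices `i ∈ {1, …, r - 1}`
such that `π_i = π_{i+1}`. -/
def plat (π : List ℕ) : ℕ :=
  ((Finset.Icc 1 (π.length - 1)).filter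
    (fun i => letter π i = letter π (i + 1))).card

/-- The multiset `{1, 1, 2, 2, …, n, n}`. -/
def doubled (n : ℕ) : Multiset ℕ := (Finset.Icc 1 n).val + (Finset.Icc 1 n).val

/-- There are no positions `1 ≤ i < j < k < l ≤ r` with `π_i = π_k` and `π_j = π_l`.
For a word in which every letter occurs at most twice, this says
that `π` avoids the patterns `1212` and `2121`. -/
def Noncrossing (π : List ℕ) : Prop :=
  ¬ ∃ i j k l : ℕ, 1 ≤ i ∧ i < j ∧ j < k ∧ k < l ∧ l ≤ π.length ∧
    letter π i = letter π k ∧ letter π j = letter π l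

open Classical in
/-- The set of quasi-Stirling permutations of size `n`: the arrangements of the multiset
`{1, 1, 2, 2, …, n, n}` in a word which are noncrossing, each word being counted once. -/
noncomputable def quasiStirling (n : ℕ) : Finset (List ℕ) :=
  (doubled n).lists.toFinset.filter Noncrossing

theorem mem_quasiStirling (n : ℕ) (π : List ℕ) :
    π ∈ quasiStirling n ↔ (π : Multiset ℕ) = doubled n ∧ Noncrossing π := by
  simp [quasiStirling, Multiset.mem_lists_iff, eq_comm]

/-- The average of a statistic `f` over the quasi-Stirling permutations of size `n`. -/
noncomputable def average (n : ℕ) (f : List ℕ → ℕ) : ℚ :=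
  (∑ π ∈ quasiStirling n, (f π : ℚ)) / ((quasiStirling n).card : ℚ)

end QuasiStirling

namespace QuasiStirling

/-! ### Relations between the statistics -/

/-! Each nonempty word satisfies asc + des + plat = length + 1 (`asc_add_des_add_plat`), and
reversal swaps ascents with descents, so only the mean of plat is needed. A nonempty quasi-Stirling
word is uniquely `a u a v` with `u`, `v` of the same kind on disjoint letters: a binary tree with
root `a` and subtrees `u`, `v`. Plateaus are the nodes with empty left subtree. The mirror image
`flip` makes them the nodes with empty right subtree. A binary tree with `n` nodes has `n + 1` empty
subtrees, so plat sums to `n + 1` over a word and its flip (`Decomposable.plat_add_plat_flip`), and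
its mean is half of that. -/

theorem sum_Icc_one (f : ℕ → ℕ) (k : ℕ) :
    ∑ i ∈ Finset.Icc 1 k, f i = ∑ i ∈ Finset.range k, f (i + 1) := by
  rw [Finset.range_eq_Ico, Finset.sum_Ico_add' f 0 k 1]
  rfl

theorem asc_add_des_add_plat {π : List ℕ} (h : π ≠ []) :
    asc π + des π + plat π = π.length + 1 := by
  obtain ⟨m, hm⟩ : ∃ m, π.length = m + 1 :=
    Nat.exists_eq_succ_of_ne_zero (by simpa using h)
  have hA : asc π = 1 + ∑ i ∈ Finset.range m,
      if letter π (i + 1) < letter π (i + 1 + 1) then 1 else 0 := by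
    rw [asc, Finset.card_filter, hm, Finset.sum_range_succ']
    simp [add_comm]
  have hD : des π = 1 + ∑ i ∈ Finset.range m,
      if letter π (i + 1) > letter π (i + 1 + 1) then 1 else 0 := by
    rw [des, Finset.card_filter, hm, sum_Icc_one, Finset.sum_range_succ, add_comm]
    congr 1
    · simp
    · refine Finset.sum_congr rfl fun i hi => ?_
      have : i ≠ m := (Finset.mem_range.mp hi).ne
      simp [this]
  have hP : plat π = ∑ i ∈ Finset.range m,
      if letter π (i + 1) = letter π (i + 1 + 1) then 1 else 0 := by
    rw [plat, Finset.card_filter, hm, sum_Icc_one]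
    rfl
  have hsum : (∑ i ∈ Finset.range m,
      if letter π (i + 1) < letter π (i + 1 + 1) then 1 else 0) + (∑ i ∈ Finset.range m,
      if letter π (i + 1) > letter π (i + 1 + 1) then 1 else 0) + (∑ i ∈ Finset.range m,
      if letter π (i + 1) = letter π (i + 1 + 1) then 1 else 0) = m := by
    rw [← Finset.sum_add_distrib, ← Finset.sum_add_distrib]
    trans ∑ i ∈ Finset.range m, 1
    · refine Finset.sum_congr rfl fun i _ => ?_
      rcases lt_trichotomy (letter π (i + 1)) (letter π (i + 1 + 1)) with h | h | h
      · simp [h, h.ne, h.le]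
      · simp [h]
      · simp [h, h.ne', h.le]
    · simp
  omega

theorem letter_reverse (π : List ℕ) {i : ℕ} (h1 : 1 ≤ i) (h2 : i ≤ π.length) :
    letter π.reverse i = letter π (π.length + 1 - i) := by
  unfold letter
  rw [List.getD_eq_getElem _ _ (by simp; omega), List.getD_eq_getElem _ _ (by omega)]
  rw [List.getElem_reverse]
  congr 1
  omega

/-- The bijection is `i ↦ π.length - i`; it matches the conventional ascent at `0` with the
conventional descent at the end. -/
theorem asc_reverse (π : List ℕ) : asc π.reverse = des π := by
  unfold asc des
  refine Finset.card_bij' (fun i _ => π.length - i) (fun i _ => π.length - i) ?_ ?_ ?_ ?_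
  · intro i hi
    simp only [Finset.mem_filter, Finset.mem_range, List.length_reverse, Finset.mem_Icc] at hi ⊢
    obtain ⟨hi, h⟩ := hi
    refine ⟨by omega, ?_⟩
    rcases Nat.eq_zero_or_pos i with h0 | h0
    · left; omega
    · right
      rcases h with h | h
      · omega
      rw [letter_reverse π h0 hi.le, letter_reverse π (by omega) (by omega)] at h
      convert h using 2 <;> omega
  · intro i hi
    simp only [Finset.mem_filter, Finset.mem_range, List.length_reverse, Finset.mem_Icc] at hi ⊢
    obtain ⟨hi, h⟩ := hi
    refine ⟨by omega, ?_⟩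
    rcases hi.2.eq_or_lt with h0 | h0
    · left; omega
    · right
      rcases h with h | h
      · omega
      rw [letter_reverse π (by omega) (by omega), letter_reverse π (by omega) (by omega)]
      convert h using 2 <;> omega
  · intro i hi
    simp only [Finset.mem_filter, Finset.mem_range, List.length_reverse] at hi
    omega
  · intro i hi
    simp only [Finset.mem_filter, Finset.mem_Icc] at hi
    omega

/-! ### Noncrossing words as words avoiding a sublist -/

theorem noncrossing_iff (π : List ℕ) :
    Noncrossing π ↔ ∀ a b : ℕ, ¬ [a, b, a, b].Sublist π := by
  unfold Noncrossing
  rw [← not_exists_not, not_iff_not]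
  simp only [not_forall, not_not]
  constructor
  · rintro ⟨i, j, k, l, hi, hij, hjk, hkl, hl, h1, h2⟩
    refine ⟨letter π i, letter π j, ?_⟩
    have hs : [i - 1, j - 1, k - 1, l - 1].map (fun m => π.getD m 0)
        = [letter π i, letter π j, letter π i, letter π j] := by
      nth_rewrite 2 [h1, h2]
      rfl
    rw [← hs]
    -- Viewing `π` as the image of its positions reduces the claim to an increasing list of
    -- positions being a sublist of the range.
    have hmap : (List.range π.length).map (fun m => π.getD m 0) = π := by
      apply List.ext_getElem
      · simp
      · intro m h _
        simp at h
        simp [h]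
    conv_rhs => rw [← hmap]
    refine List.Sublist.map _ ?_
    refine List.sublist_of_subperm_of_sortedLE ?_ ?_ ?_
    · refine List.subperm_of_subset ?_ ?_
      · simp; omega
      · intro x hx
        simp at hx ⊢
        omega
    · simp [List.sortedLE_iff_pairwise]; omega
    · exact (List.pairwise_le_range).sortedLE
  · rintro ⟨a, b, h⟩
    obtain ⟨f, hf⟩ := List.sublist_iff_exists_fin_orderEmbedding_get_eq.mp h
    refine ⟨f ⟨0, by simp⟩ + 1, f ⟨1, by simp⟩ + 1, f ⟨2, by simp⟩ + 1, f ⟨3, by simp⟩ + 1,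
      by omega, ?_, ?_, ?_, ?_, ?_, ?_⟩
    · have : f ⟨0, by simp⟩ < f ⟨1, by simp⟩ := f.lt_iff_lt.mpr (by simp)
      simpa only [add_lt_add_iff_right, Fin.val_fin_lt] using this
    · have : f ⟨1, by simp⟩ < f ⟨2, by simp⟩ := f.lt_iff_lt.mpr (by simp)
      simpa only [add_lt_add_iff_right, Fin.val_fin_lt] using this
    · have : f ⟨2, by simp⟩ < f ⟨3, by simp⟩ := f.lt_iff_lt.mpr (by simp)
      simpa only [add_lt_add_iff_right, Fin.val_fin_lt] using this
    · have := (f ⟨3, by simp⟩).2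
      omega
    · have h0 := hf ⟨0, by simp⟩
      have h2 := hf ⟨2, by simp⟩
      simp at h0 h2
      simp [letter, ← h0, ← h2]
    · have h0 := hf ⟨1, by simp⟩
      have h2 := hf ⟨3, by simp⟩
      simp at h0 h2
      simp [letter, ← h0, ← h2]

theorem Noncrossing.reverse {π : List ℕ} (h : Noncrossing π) : Noncrossing π.reverse := by
  rw [noncrossing_iff] at h ⊢
  intro a b hab
  have := hab.reverse
  rw [List.reverse_reverse] at this
  exact h b a (by simpa using this)

/-! ### Recursive decomposition -/

/-- Words of the form `a u a v`, where `u` and `v` are again of this form, with no common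
letter and not containing `a`, or empty. -/
inductive Decomposable : List ℕ → Prop
  | nil : Decomposable []
  | node {a : ℕ} {u v : List ℕ} : Decomposable u → Decomposable v → a ∉ u → a ∉ v →
      List.Disjoint u v → Decomposable (a :: (u ++ a :: v))

theorem Decomposable.count_eq_two {w : List ℕ} (h : Decomposable w) :
    ∀ b ∈ w, w.count b = 2 := by
  induction h with
  | nil => simp
  | @node a u v _ _ hau hav hd ihu ihv =>
    intro b hb
    have hu : b ∉ u → u.count b = 0 := List.count_eq_zero_of_not_mem
    have hv : b ∉ v → v.count b = 0 := List.count_eq_zero_of_not_mem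
    have hd' : b ∈ u → b ∉ v := fun h h' => hd h h'
    simp only [List.mem_cons, List.mem_append] at hb
    simp only [List.count_cons, List.count_append]
    grind

theorem Decomposable.noncrossing {w : List ℕ} (h : Decomposable w) : Noncrossing w := by
  rw [noncrossing_iff]
  induction h with
  | nil => simp
  | @node a u v _ _ hau hav hd ihu ihv =>
    intro x y hxy
    rw [← List.cons_append, List.sublist_append_iff] at hxy
    obtain ⟨l₁, l₂, h, h₁, h₂⟩ := hxy
    have hd' : ∀ b, b ∈ u → b ∈ v → False := fun b h h' => hd h h'
    have hcons : ∀ (c : ℕ) (l t : List ℕ), (c :: l).Sublist (a :: t) →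
        (c :: l).Sublist t ∨ c = a ∧ l ⊆ t := by
      intro c l t h
      rcases List.sublist_cons_iff.mp h with h | ⟨r, hr, h⟩
      · exact .inl h
      · obtain ⟨rfl, rfl⟩ := List.cons.inj hr
        exact .inr ⟨rfl, h.subset⟩
    have m₁ := h₁.subset
    have m₂ := h₂.subset
    -- Split by how many letters of the pattern fall in `a :: u`. A proper cut puts a letter in both
    -- halves, against disjointness or the absence of `a` from `u` and `v`.
    rcases l₁ with _ | ⟨p, _ | ⟨q, _ | ⟨r, _ | ⟨s, _ | ⟨t, l₁⟩⟩⟩⟩⟩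
    · obtain rfl : l₂ = [x, y, x, y] := h.symm
      rcases hcons _ _ _ h₂ with h | ⟨rfl, h⟩
      · exact ihv _ _ h
      · exact hav (h (by simp))
    · simp only [List.cons_append, List.nil_append, List.cons.injEq] at h
      obtain ⟨rfl, rfl⟩ := h
      have := hcons _ _ _ h₂
      have := @List.Sublist.subset _ [y, x, y] v
      simp only [List.cons_subset, List.mem_cons] at *
      grind only
    · simp only [List.cons_append, List.nil_append, List.cons.injEq] at h
      obtain ⟨rfl, rfl, rfl⟩ := h
      have := hcons _ _ _ h₁
      have := @List.Sublist.subset _ [x, y] u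
      simp only [List.cons_subset, List.mem_cons] at *
      grind only
    · simp only [List.cons_append, List.nil_append, List.cons.injEq] at h
      obtain ⟨rfl, rfl, rfl, rfl⟩ := h
      have := hcons _ _ _ h₁
      have := @List.Sublist.subset _ [x, y, x] u
      simp only [List.cons_subset, List.mem_cons] at *
      grind only
    · simp only [List.cons_append, List.nil_append, List.cons.injEq] at h
      obtain ⟨rfl, rfl, rfl, rfl, rfl⟩ := h
      rcases hcons _ _ _ h₁ with h | ⟨rfl, h⟩
      · exact ihu _ _ h
      · exact hau (h (by simp))
    · simp at h

theorem decomposable_of_noncrossing (w : List ℕ) (hw : ∀ b ∈ w, w.count b = 2)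
    (h : Noncrossing w) : Decomposable w := by
  rw [noncrossing_iff] at h
  induction hn : w.length using Nat.strong_induction_on generalizing w with
  | _ n ih =>
  match w with
  | [] => exact .nil
  | a :: t =>
    have ha : t.count a = 1 := by simpa using hw a (by simp)
    obtain ⟨u, v, rfl, hau⟩ := List.eq_append_cons_of_mem (List.count_pos_iff.mp (ha ▸ one_pos))
    have hav : a ∉ v := by
      rw [← List.count_eq_zero]
      simp only [List.count_append, List.count_cons_self] at ha
      omega
    have hd : List.Disjoint u v := by
      intro b hu hv
      -- A letter `b` common to `u` and `v` would produce `a b a b`.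
      refine h a b (.cons_cons a ?_)
      exact .append (List.singleton_sublist.mpr hu) (.cons_cons a (List.singleton_sublist.mpr hv))
    simp only [List.length_cons, List.length_append] at hn
    refine .node (ih u.length (by omega) u ?_ ?_ rfl) (ih v.length (by omega) v ?_ ?_ rfl) hau hav hd
    · intro b hb
      have h1 := hw b (by simp [hb])
      have h2 : v.count b = 0 := List.count_eq_zero.mpr fun h => hd hb h
      have h3 : a ≠ b := fun h => hau (h ▸ hb)
      simpa [List.count_cons, List.count_append, h2, h3] using h1
    · exact fun x y hxy => h x y (.cons _ (hxy.trans (List.sublist_append_left _ _)))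
    · intro b hb
      have h1 := hw b (by simp [hb])
      have h2 : u.count b = 0 := List.count_eq_zero.mpr fun h => hd h hb
      have h3 : a ≠ b := fun h => hav (h ▸ hb)
      simpa [List.count_cons, List.count_append, h2, h3] using h1
    · exact fun x y hxy => h x y (.cons _ ((hxy.cons _).trans (List.sublist_append_right _ _)))

/-! ### Plateaus -/

theorem plat_cons_cons (a b : ℕ) (l : List ℕ) :
    plat (a :: b :: l) = (if a = b then 1 else 0) + plat (b :: l) := by
  simp only [plat, Finset.card_filter, sum_Icc_one, List.length_cons, Nat.add_sub_cancel,
    Finset.sum_range_succ', letter]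
  rw [add_comm]
  simp

@[simp] theorem plat_nil : plat [] = 0 := by simp [plat]

@[simp] theorem plat_singleton (a : ℕ) : plat [a] = 0 := by simp [plat]

theorem plat_cons_of_notMem {a : ℕ} {v : List ℕ} (h : a ∉ v) : plat (a :: v) = plat v := by
  cases v with
  | nil => simp
  | cons b v =>
    have : a ≠ b := by rintro rfl; simp at h
    simp [plat_cons_cons, this]

theorem plat_append_cons_of_notMem {a : ℕ} {u v : List ℕ} (hu : a ∉ u) (hv : a ∉ v) :
    plat (u ++ a :: v) = plat u + plat v := by
  induction u with
  | nil => simp [plat_cons_of_notMem hv]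
  | cons b u ih =>
    simp only [List.mem_cons, not_or] at hu
    specialize ih hu.2
    cases u with
    | nil =>
      simp only [List.nil_append, List.cons_append, plat_nil] at ih ⊢
      simp [plat_cons_cons, ih, Ne.symm hu.1]
    | cons c u =>
      simp only [List.cons_append] at ih ⊢
      rw [plat_cons_cons, ih, plat_cons_cons, add_assoc]

/-- The two copies of `a` form a plateau exactly when nothing separates them; no other plateau
involves `a`. -/
theorem plat_node {a : ℕ} {u v : List ℕ} (hu : a ∉ u) (hv : a ∉ v) :
    plat (a :: (u ++ a :: v)) = (if u = [] then 1 else plat u) + plat v := by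
  cases u with
  | nil => simp [plat_cons_cons, plat_cons_of_notMem hv]
  | cons b u =>
    have hab : a ≠ b := by rintro rfl; simp at hu
    rw [List.cons_append, plat_cons_cons, ← List.cons_append, plat_append_cons_of_notMem hu hv]
    simp [hab]

/-! ### The involution -/

/-- The map which sends `a u a v` to `a v' a u'`, where `u'` and `v'` are the images of
`u` and `v`. -/
def flip : List ℕ → List ℕ
  | [] => []
  | a :: t =>
    a :: (flip (t.dropWhile (· != a)).tail ++ a :: flip (t.takeWhile (· != a)))
termination_by w => w.length
decreasing_by
  · have := (List.dropWhile_sublist (l := t) (· != a)).length_le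
    simp; omega
  · have := (List.takeWhile_sublist (l := t) (· != a)).length_le
    simp; omega

@[simp] theorem flip_nil : flip [] = [] := by simp [flip]

theorem flip_node {a : ℕ} {u v : List ℕ} (hu : a ∉ u) :
    flip (a :: (u ++ a :: v)) = a :: (flip v ++ a :: flip u) := by
  have h : ∀ x ∈ u, (x != a) = true := by
    intro x hx
    simpa using fun h : x = a => hu (h ▸ hx)
  rw [flip, List.dropWhile_append_of_pos h, List.takeWhile_append_of_pos h]
  simp

theorem Decomposable.flip_perm {w : List ℕ} (h : Decomposable w) : (flip w).Perm w := by
  induction h with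
  | nil => simp
  | @node a u v _ _ hau hav hd ihu ihv =>
    rw [flip_node hau]
    refine .cons _ ((ihv.append (ihu.cons a)).trans ?_)
    rw [List.perm_iff_count]
    intro b
    simp only [List.count_append, List.count_cons]
    omega

theorem Decomposable.flip {w : List ℕ} (h : Decomposable w) : Decomposable (flip w) := by
  induction h with
  | nil => simpa using Decomposable.nil
  | @node a u v hu hv hau hav hd ihu ihv =>
    rw [flip_node hau]
    refine .node ihv ihu ?_ ?_ ?_
    · rwa [hv.flip_perm.mem_iff]
    · rwa [hu.flip_perm.mem_iff]
    · intro b h1 h2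
      exact hd (hu.flip_perm.mem_iff.mp h2) (hv.flip_perm.mem_iff.mp h1)

theorem Decomposable.flip_flip {w : List ℕ} (h : Decomposable w) :
    QuasiStirling.flip (QuasiStirling.flip w) = w := by
  induction h with
  | nil => simp
  | @node a u v hu hv hau hav hd ihu ihv =>
    rw [flip_node hau, flip_node (by rwa [hv.flip_perm.mem_iff]), ihu, ihv]

theorem Decomposable.plat_add_plat_flip {w : List ℕ} (h : Decomposable w) :
    2 * (plat w + plat (QuasiStirling.flip w)) = if w = [] then 0 else w.length + 2 := by
  induction h with
  | nil => simp
  | @node a u v hu hv hau hav hd ihu ihv =>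
    have hau' : a ∉ QuasiStirling.flip u := by rwa [hu.flip_perm.mem_iff]
    have hav' : a ∉ QuasiStirling.flip v := by rwa [hv.flip_perm.mem_iff]
    -- An empty `u` or `v` adds `1` in exactly one of the two words, replacing its missing induction
    -- value.
    have hv0 : QuasiStirling.flip v = [] ↔ v = [] := by
      rw [← List.length_eq_zero_iff, hv.flip_perm.length_eq, List.length_eq_zero_iff]
    rw [flip_node hau, plat_node hau hav, plat_node hav' hau']
    simp only [hv0, List.length_cons, List.length_append, reduceCtorEq, if_false]
    split_ifs at * <;> simp_all <;> omega

/-! ### Averages -/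

theorem count_doubled (n b : ℕ) : (doubled n).count b = if b ∈ Finset.Icc 1 n then 2 else 0 := by
  have := Multiset.count_eq_of_nodup (a := b) (Finset.Icc 1 n).nodup
  rw [doubled, Multiset.count_add, this]
  simp only [Finset.mem_val]
  split_ifs <;> rfl

theorem length_of_mem {n : ℕ} {π : List ℕ} (h : π ∈ quasiStirling n) : π.length = 2 * n := by
  rw [mem_quasiStirling] at h
  rw [← Multiset.coe_card, h.1]
  simp [doubled]
  omega

theorem decomposable_of_mem {n : ℕ} {π : List ℕ} (h : π ∈ quasiStirling n) : Decomposable π := by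
  rw [mem_quasiStirling] at h
  refine decomposable_of_noncrossing π (fun b hb => ?_) h.2
  have hc : π.count b = (doubled n).count b := by rw [← h.1, Multiset.coe_count]
  have : 0 < π.count b := List.count_pos_iff.mpr hb
  rw [count_doubled] at hc
  split_ifs at hc <;> omega

theorem Decomposable.mem_quasiStirling_of_perm {n : ℕ} {π σ : List ℕ} (hσ : Decomposable σ)
    (h : σ.Perm π) (hπ : π ∈ quasiStirling n) : σ ∈ quasiStirling n := by
  rw [mem_quasiStirling] at hπ ⊢
  exact ⟨(Multiset.coe_eq_coe.mpr h).trans hπ.1, hσ.noncrossing⟩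

theorem reverse_mem {n : ℕ} {π : List ℕ} (h : π ∈ quasiStirling n) :
    π.reverse ∈ quasiStirling n := by
  rw [mem_quasiStirling] at h ⊢
  exact ⟨(Multiset.coe_eq_coe.mpr π.reverse_perm).trans h.1, h.2.reverse⟩

theorem quasiStirling_nonempty (n : ℕ) : (quasiStirling n).Nonempty := by
  suffices h : ∃ π : List ℕ, (π : Multiset ℕ) = doubled n ∧ Decomposable π by
    obtain ⟨π, h1, h2⟩ := h
    exact ⟨π, (mem_quasiStirling n π).mpr ⟨h1, h2.noncrossing⟩⟩
  induction n with
  | zero => exact ⟨[], by simp [doubled], .nil⟩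
  | succ n ih =>
    obtain ⟨π, h1, h2⟩ := ih
    have hn : n + 1 ∉ π := by
      rw [← Multiset.mem_coe, h1]
      simp [doubled]
    -- The witness is `n n … 2 2 1 1`.
    refine ⟨(n + 1) :: ([] ++ (n + 1) :: π), ?_, .node .nil h2 (by simp) hn (by simp)⟩
    have : Finset.Icc 1 (n + 1) = insert (n + 1) (Finset.Icc 1 n) := by
      ext; simp; omega
    rw [doubled, this, Finset.insert_val_of_notMem (by simp)]
    simp only [List.nil_append, ← Multiset.cons_coe, h1, doubled]
    simp

theorem sum_asc_eq_sum_des (n : ℕ) :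
    ∑ π ∈ quasiStirling n, (asc π : ℚ) = ∑ π ∈ quasiStirling n, (des π : ℚ) := by
  refine Finset.sum_nbij' List.reverse List.reverse (fun _ => reverse_mem) (fun _ => reverse_mem)
    (fun _ _ => List.reverse_reverse _) (fun _ _ => List.reverse_reverse _) fun π _ => ?_
  rw [← asc_reverse, List.reverse_reverse]

theorem sum_plat_eq_sum_plat_flip (n : ℕ) :
    ∑ π ∈ quasiStirling n, (plat π : ℚ) =
      ∑ π ∈ quasiStirling n, (plat (QuasiStirling.flip π) : ℚ) := by
  have hmem : ∀ π ∈ quasiStirling n, QuasiStirling.flip π ∈ quasiStirling n := fun π h =>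
    (decomposable_of_mem h).flip.mem_quasiStirling_of_perm (decomposable_of_mem h).flip_perm h
  refine Finset.sum_nbij' QuasiStirling.flip QuasiStirling.flip hmem hmem
    (fun _ h => (decomposable_of_mem h).flip_flip)
    (fun _ h => (decomposable_of_mem h).flip_flip) fun π h => ?_
  rw [(decomposable_of_mem h).flip_flip]

theorem average_asc_and_des_and_plat (n : ℕ) (hn : 1 ≤ n) :
    average n asc = (3 * (n : ℚ) + 1) / 4 ∧
    average n des = (3 * (n : ℚ) + 1) / 4 ∧
    average n plat = ((n : ℚ) + 1) / 2 := by
  have hne : ∀ π ∈ quasiStirling n, π ≠ [] := by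
    rintro π h rfl
    have := length_of_mem h
    simp at this
    omega
  have hcard : ((quasiStirling n).card : ℚ) ≠ 0 := by
    exact_mod_cast (quasiStirling_nonempty n).card_pos.ne'
  have hP : 2 * ∑ π ∈ quasiStirling n, (plat π : ℚ) = (quasiStirling n).card * ((n : ℚ) + 1) := by
    rw [two_mul]
    nth_rewrite 2 [sum_plat_eq_sum_plat_flip n]
    rw [← Finset.sum_add_distrib, ← nsmul_eq_mul, ← Finset.sum_const]
    refine Finset.sum_congr rfl fun π h => ?_
    have h1 := (decomposable_of_mem h).plat_add_plat_flip
    rw [if_neg (hne π h), length_of_mem h] at h1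
    have h2 : plat π + plat (QuasiStirling.flip π) = n + 1 := by omega
    exact_mod_cast h2
  have hT : ∑ π ∈ quasiStirling n, (asc π : ℚ) + ∑ π ∈ quasiStirling n, (des π : ℚ) +
      ∑ π ∈ quasiStirling n, (plat π : ℚ) = (quasiStirling n).card * (2 * (n : ℚ) + 1) := by
    rw [← Finset.sum_add_distrib, ← Finset.sum_add_distrib, ← nsmul_eq_mul, ← Finset.sum_const]
    refine Finset.sum_congr rfl fun π h => ?_
    have h1 := asc_add_des_add_plat (hne π h)
    rw [length_of_mem h] at h1
    exact_mod_cast h1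
  have hAD := sum_asc_eq_sum_des n
  unfold average
  refine ⟨?_, ?_, ?_⟩ <;> rw [div_eq_iff hcard] <;> linarith

end QuasiStirling

theorem corollary3p1 (n : ℕ) (hn : 1 ≤ n) :
    QuasiStirling.average n QuasiStirling.asc = (3 * (n : ℚ) + 1) / 4 ∧
    QuasiStirling.average n QuasiStirling.des = (3 * (n : ℚ) + 1) / 4 ∧
    QuasiStirling.average n QuasiStirling.plat = ((n : ℚ) + 1) / 2 :=
  QuasiStirling.average_asc_and_des_and_plat n hn
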